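/- A structure with finitely many binary relations is said to have an \(X\)-computable copy (for an oracle \(X\)) if it is isomorphic to a structure whose domain is an \(X\)-computable set of natural numbers and whose relations are \(X\)-computable; "computable" means computable without an oracle, and \(0'\) denotes the halting set. Theorem. Let \(L\) be a linear order in which every element has an immediate successor and an immediate predecessor, and let \(S(x,y)\) be the successor relation "\(y\) is the immediate successor of \(x\)". If the structure \((L,<,S)\) has a \(0'\)-computable copy, then the structure \((L,<)\) has a computable copy. -/

import Mathlib

/-- `p` is decidable relative to the oracles in `O`: its characteristic function is total and
computable in `O`. -/
def DecidablePredIn {α : Type*} [Primcodable α] (O : Set (ℕ →. ℕ)) (p : α → Prop) : Prop :=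
  ∃ _ : DecidablePred p, ComputableIn O fun a => decide (p a)

/-- Without oracles this is Mathlib's notion of a computable predicate. -/
theorem decidablePredIn_empty_iff {α : Type*} [Primcodable α] (p : α → Prop) :
    DecidablePredIn ∅ p ↔ ComputablePred p := by
  constructor
  · rintro ⟨h, hc⟩
    exact ⟨h, RecursiveIn.partrec_of_oracle (by simp) hc⟩
  · rintro ⟨h, hc⟩
    exact ⟨h, hc.computableIn⟩

open Classical in
/-- The oracle `0'`: the (total) characteristic function of the halting set
`{n | the n-th partial recursive function halts on input n}`. -/
noncomputable def zeroJump : ℕ →. ℕ := fun n =>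
  Part.some (if (Nat.Partrec.Code.eval (Denumerable.ofNat Nat.Partrec.Code n) n).Dom then 1 else 0)

/-- A structure for a signature of `k` binary relation symbols, whose domain is a set of natural
numbers. -/
structure NatStructure (k : ℕ) where
  domain : Set ℕ
  rel : Fin k → domain → domain → Prop

/-- The structure is computable in `O`: its domain is a set computable in `O`, and so is each of
its finitely many relations, as a set of pairs of natural numbers (so the atomic diagram is
computable in `O`, equality being that of natural numbers). -/
def NatStructure.IsComputableIn {k : ℕ} (O : Set (ℕ →. ℕ)) (A : NatStructure k) : Prop :=
  DecidablePredIn O (fun n : ℕ => n ∈ A.domain) ∧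
  ∀ i : Fin k, DecidablePredIn O fun p : ℕ × ℕ =>
    ∃ (h₁ : p.1 ∈ A.domain) (h₂ : p.2 ∈ A.domain), A.rel i ⟨p.1, h₁⟩ ⟨p.2, h₂⟩

/-- The structure `(M, R 0, …, R (k - 1))` has a copy computable in `O`: it is isomorphic to a
structure on a set of natural numbers that is computable in `O`. -/
def HasCopyComputableIn {M : Type*} {k : ℕ} (O : Set (ℕ →. ℕ)) (R : Fin k → M → M → Prop) :
    Prop :=
  ∃ A : NatStructure k, A.IsComputableIn O ∧
    ∃ e : M ≃ A.domain, ∀ (i : Fin k) (x y : M), R i x y ↔ A.rel i (e x) (e y)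

/-! By the limit lemma, the copy of `(L, <, S)` is a limit of primitive recursive guesses. Build an
order on all of `ℕ`, inserting the element `s` at stage `s`. If the guess on the labels up to `n`
last changed exactly `n` stages ago, is coherent and contains `n`, then `s` represents `n`: it goes
to the very bottom if `n` is guessed below all validly represented smaller labels, and otherwise
just below the least valid representative guessed above `n`. In all other cases it goes on top.
Nothing is ever removed, so wrong guesses leave junk.

Every point of `L` gets a final representative, and these are ordered correctly. The successor
relation bounds the junk: once `x ⋖ y` is settled, no coherent guess puts a new label between `x`
and `y` (`not_between`). Insertion at the bottom makes the final representatives coinitial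
(`exists_prec`), so each `b` can be sent to the greatest `x` whose final representative is not above
`b` (`exists_greatest`). This is a monotone surjection onto `L` with finite fibres. By
`exists_orderIso_of_finite_fibers` it forces an isomorphism: the points at finite distance from a
given one form a copy of `ℤ`, and thickening the points of `ℤ` to nonempty finite chains gives `ℤ`
again. -/

/-! ### Order types: blocks of points at finite distance. -/

theorem exists_orderIso_int_of_finite_Icc {X : Type*} [LinearOrder X] (S : Set X)
    (hne : S.Nonempty) (hfin : ∀ a ∈ S, ∀ b ∈ S, (Set.Icc a b).Finite)
    (hmax : ∀ a ∈ S, ∃ b ∈ S, a < b) (hmin : ∀ a ∈ S, ∃ b ∈ S, b < a) :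
    Nonempty (S ≃o ℤ) := by
  classical
  have : Nonempty S := hne.to_subtype
  have : NoMaxOrder S := ⟨fun a => by
    obtain ⟨b, hb, h⟩ := hmax a a.2
    exact ⟨⟨b, hb⟩, h⟩⟩
  have : NoMinOrder S := ⟨fun a => by
    obtain ⟨b, hb, h⟩ := hmin a a.2
    exact ⟨⟨b, hb⟩, h⟩⟩
  let _ : LocallyFiniteOrder S := LocallyFiniteOrder.ofFiniteIcc fun a b =>
    ((hfin a a.2 b b.2).preimage Subtype.val_injective.injOn).subset fun x hx => hx
  let _ : SuccOrder S := LinearLocallyFiniteOrder.succOrder S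
  let _ : PredOrder S := LinearLocallyFiniteOrder.predOrder S
  exact ⟨orderIsoIntOfLinearSuccPredArch⟩

/-- Two points of a linear order are related if there are finitely many points between them. -/
def finiteDistance (L : Type*) [LinearOrder L] : Setoid L where
  r a b := (Set.uIcc a b).Finite
  iseqv :=
    { refl := fun a => by simp
      symm := fun h => by rwa [Set.uIcc_comm]
      trans := fun h h' => (h.union h').subset Set.uIcc_subset_uIcc_union_uIcc }

theorem finiteDistance_iff {L : Type*} [LinearOrder L] {a b : L} :
    finiteDistance L a b ↔ (Set.uIcc a b).Finite := Iff.rfl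

/-- Blocks are convex, so two different blocks compare as wholes. This lets block isomorphisms be
glued. -/
theorem finiteDistance_lt {L : Type*} [LinearOrder L] {a a' c c' : L} (h : a < a')
    (hn : ¬ finiteDistance L a a') (hc : finiteDistance L c a) (hc' : finiteDistance L c' a') :
    c < c' := by
  by_contra! hle
  rcases le_or_gt c' a with h1 | h1
  · refine hn (hc'.subset ?_)
    rw [Set.uIcc_of_le h.le, Set.uIcc_of_le (h1.trans h.le)]
    exact Set.Icc_subset_Icc_left h1
  · refine hn ((finiteDistance L).trans' (y := c') ?_ hc')
    refine Set.Finite.subset hc ?_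
    rw [Set.uIcc_of_le h1.le, Set.uIcc_of_ge (h1.le.trans hle)]
    exact Set.Icc_subset_Icc_right hle

theorem finiteDistance_of_covBy {L : Type*} [LinearOrder L] {a b : L} (h : a ⋖ b) :
    finiteDistance L a b := by
  rw [finiteDistance_iff, Set.uIcc_of_le h.le, h.Icc_eq]
  exact Set.toFinite _

/-- In a linear order all of whose elements have immediate neighbours, replacing every point by a
nonempty finite chain does not change the order type. -/
theorem exists_orderIso_of_finite_fibers {L B : Type*} [LinearOrder L] [LinearOrder B]
    (hsucc : ∀ x : L, ∃ y : L, x ⋖ y) (hpred : ∀ x : L, ∃ y : L, y ⋖ x)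
    (f : B → L) (hmono : Monotone f) (hsurj : f.Surjective)
    (hfin : ∀ x, (f ⁻¹' {x}).Finite) : Nonempty (B ≃o L) := by
  classical
  have hblock : ∀ a : L, Nonempty
      ({b : B | finiteDistance L (f b) a} ≃o {x : L | finiteDistance L x a}) := by
    intro a
    have hS : ∀ x y : L, finiteDistance L x a → finiteDistance L y a →
        (Set.Icc x y).Finite := fun x y hx hy =>
      ((finiteDistance L).trans' hx ((finiteDistance L).symm' hy) :
        (Set.uIcc x y).Finite).subset Set.Icc_subset_uIcc
    have up : ∀ x : L, finiteDistance L x a → ∃ y, finiteDistance L y a ∧ x < y := by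
      intro x hx
      obtain ⟨y, hy⟩ := hsucc x
      exact ⟨y, (finiteDistance L).trans'
        ((finiteDistance L).symm' (finiteDistance_of_covBy hy)) hx, hy.lt⟩
    have down : ∀ x : L, finiteDistance L x a → ∃ y, finiteDistance L y a ∧ y < x := by
      intro x hx
      obtain ⟨y, hy⟩ := hpred x
      exact ⟨y, (finiteDistance L).trans' (finiteDistance_of_covBy hy) hx, hy.lt⟩
    obtain ⟨e₁⟩ := exists_orderIso_int_of_finite_Icc {x : L | finiteDistance L x a}
      ⟨a, (finiteDistance L).refl' a⟩ (fun x hx y hy => hS x y hx hy) up down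
    obtain ⟨e₂⟩ := exists_orderIso_int_of_finite_Icc {b : B | finiteDistance L (f b) a}
      (by
        obtain ⟨b, hb⟩ := hsurj a
        exact ⟨b, by simp [hb]⟩)
      (fun x hx y hy => ((hS _ _ hx hy).preimage' fun z _ => hfin z).subset
        fun z hz => ⟨hmono hz.1, hmono hz.2⟩)
      (fun x hx => by
        obtain ⟨y, hy, hlt⟩ := up _ hx
        obtain ⟨b, rfl⟩ := hsurj y
        exact ⟨b, hy, lt_of_not_ge fun hle => hlt.not_ge (hmono hle)⟩)
      (fun x hx => by
        obtain ⟨y, hy, hlt⟩ := down _ hx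
        obtain ⟨b, rfl⟩ := hsurj y
        exact ⟨b, hy, lt_of_not_ge fun hle => hlt.not_ge (hmono hle)⟩)
    exact ⟨e₂.trans e₁.symm⟩
  have e := fun a => (hblock a).some
  -- One base point per block, so that all points of a block use the same isomorphism.
  let r : L → L := fun x => (Quotient.mk (finiteDistance L) x).out
  have hr : ∀ x, finiteDistance L x (r x) := fun x =>
    (finiteDistance L).symm' (Quotient.mk_out x)
  have hr' : ∀ x y, finiteDistance L x y → r x = r y := fun x y h => by
    simp only [r]; rw [Quotient.sound h]
  let F : B → L := fun b => (e (r (f b)) ⟨b, hr (f b)⟩ : {x : L | finiteDistance L x _}).1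
  have hF : ∀ a b (h : finiteDistance L (f b) a), a = r (f b) → F b = e a ⟨b, h⟩ := by
    rintro _ b h rfl
    rfl
  have hF' : ∀ b, finiteDistance L (F b) (f b) := fun b =>
    (finiteDistance L).trans' (e (r (f b)) ⟨b, hr (f b)⟩).2 ((finiteDistance L).symm' (hr _))
  have hstrict : StrictMono F := by
    intro b b' hb
    by_cases h : finiteDistance L (f b) (f b')
    · have h1 := hr' _ _ h
      rw [hF (r (f b)) b (hr _) rfl, hF (r (f b)) b' (h1 ▸ hr _) h1]
      exact (e (r (f b))).strictMono hb
    · refine finiteDistance_lt (lt_of_le_of_ne (hmono hb.le) ?_) h (hF' b) (hF' b')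
      intro heq
      exact h (heq ▸ (finiteDistance L).refl' _)
  have hFsurj : F.Surjective := by
    intro x
    obtain ⟨⟨b, hb⟩, h⟩ := (e (r x)).surjective ⟨x, hr x⟩
    refine ⟨b, ?_⟩
    have hb' : finiteDistance L (f b) (r x) := hb
    rw [hF (r x) b hb' (hr' _ _ ((finiteDistance L).trans' (hr x)
      ((finiteDistance L).symm' hb')))]
    rw [h]
  exact ⟨hstrict.orderIsoOfSurjective F hFsurj⟩

/-! ### The limit lemma. -/

open Filter in
/-- The limit lemma: a function recursive in the halting set is the pointwise limit of a
primitive recursive sequence wherever it is defined. -/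
theorem exists_primrec_limit_of_recursiveIn_zeroJump {f : ℕ →. ℕ} (hf : Nat.RecursiveIn {zeroJump} f) :
    ∃ g : ℕ → ℕ → ℕ, Primrec₂ g ∧ ∀ n, ∀ v ∈ f n, ∀ᶠ s in atTop, g s n = v := by
  induction hf with
  | zero =>
    refine ⟨fun _ _ => 0, Primrec₂.const 0, fun n v hv => .of_forall fun s => ?_⟩
    exact (Part.mem_some_iff.1 hv).symm
  | succ =>
    refine ⟨fun _ n => n.succ, Primrec.succ.comp Primrec.snd, fun n v hv => .of_forall fun s => ?_⟩
    exact (Part.mem_some_iff.1 hv).symm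
  | left =>
    refine ⟨fun _ n => n.unpair.1, (Primrec.fst.comp Primrec.unpair).comp Primrec.snd,
      fun n v hv => .of_forall fun s => ?_⟩
    exact (Part.mem_some_iff.1 hv).symm
  | right =>
    refine ⟨fun _ n => n.unpair.2, (Primrec.snd.comp Primrec.unpair).comp Primrec.snd,
      fun n v hv => .of_forall fun s => ?_⟩
    exact (Part.mem_some_iff.1 hv).symm
  | oracle g hg =>
    classical
    obtain rfl : g = zeroJump := hg
    refine ⟨fun s n => bif (Nat.Partrec.Code.evaln s (Denumerable.ofNat _ n) n).isSome
      then 1 else 0, ?_, fun n v hv => ?_⟩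
    · refine Primrec.cond (Primrec.option_isSome.comp ?_) (Primrec.const 1) (Primrec.const 0)
      exact Nat.Partrec.Code.primrec_evaln.comp (Primrec.pair (Primrec.pair Primrec.fst
        ((Primrec.ofNat _).comp Primrec.snd)) Primrec.snd)
    · have hv := Part.mem_some_iff.1 hv
      split_ifs at hv with hd
      · obtain ⟨w, hw⟩ := Part.dom_iff_mem.1 hd
        obtain ⟨k, hk⟩ := Nat.Partrec.Code.evaln_complete.1 hw
        filter_upwards [eventually_ge_atTop k] with s hs
        rw [Option.mem_def.1 (Nat.Partrec.Code.evaln_mono hs hk), hv]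
        rfl
      · refine .of_forall fun s => ?_
        rcases ho : Nat.Partrec.Code.evaln s (Denumerable.ofNat _ n) n with _ | w
        · simp [ho, hv]
        · exact absurd (Part.dom_iff_mem.2 ⟨w, Nat.Partrec.Code.evaln_sound ho⟩) hd
  | pair _ _ ih₁ ih₂ =>
    obtain ⟨g₁, hg₁, h₁⟩ := ih₁
    obtain ⟨g₂, hg₂, h₂⟩ := ih₂
    refine ⟨fun s n => Nat.pair (g₁ s n) (g₂ s n), Primrec₂.natPair.comp hg₁ hg₂,
      fun n v hv => ?_⟩
    simp only [Seq.seq, Part.mem_bind_iff, Part.map_eq_map, Part.mem_map_iff] at hv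
    obtain ⟨_, ⟨a, ha, rfl⟩, b, hb, rfl⟩ := hv
    filter_upwards [h₁ n a ha, h₂ n b hb] with s hs hs'
    rw [hs, hs']
  | comp _ _ ih₁ ih₂ =>
    obtain ⟨g₁, hg₁, h₁⟩ := ih₁
    obtain ⟨g₂, hg₂, h₂⟩ := ih₂
    refine ⟨fun s n => g₁ s (g₂ s n), hg₁.comp Primrec.fst hg₂, fun n v hv => ?_⟩
    obtain ⟨w, hw, hv⟩ := Part.mem_bind_iff.1 hv
    filter_upwards [h₁ w v hv, h₂ n w hw] with s hs hs'
    rw [hs', hs]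
  | @prec f h _ _ ih₁ ih₂ =>
    obtain ⟨g₁, hg₁, h₁⟩ := ih₁
    obtain ⟨g₂, hg₂, h₂⟩ := ih₂
    refine ⟨fun s p => Nat.rec (g₁ s p.unpair.1)
      (fun y IH => g₂ s (Nat.pair p.unpair.1 (Nat.pair y IH))) p.unpair.2, ?_, fun p v hv => ?_⟩
    · have hfst : Primrec fun q : ℕ × ℕ => q.2.unpair.1 :=
        Primrec.fst.comp (Primrec.unpair.comp Primrec.snd)
      exact Primrec.nat_rec' (Primrec.snd.comp (Primrec.unpair.comp Primrec.snd))
        (hg₁.comp Primrec.fst hfst)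
        (Primrec.to₂ <| hg₂.comp (Primrec.fst.comp Primrec.fst) (Primrec₂.natPair.comp (hfst.comp Primrec.fst)
          (Primrec₂.natPair.comp (Primrec.fst.comp Primrec.snd) (Primrec.snd.comp Primrec.snd))))
    · change v ∈ Nat.rec (motive := fun _ => Part ℕ) (f p.unpair.1)
        (fun y IH => IH >>= fun i => h (Nat.pair p.unpair.1 (Nat.pair y i))) p.unpair.2 at hv
      beta_reduce
      generalize p.unpair.2 = k at hv
      generalize p.unpair.1 = a at hv
      induction k generalizing v with
      | zero => exact h₁ a v hv
      | succ k ih =>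
        obtain ⟨i, hi, hv⟩ := Part.mem_bind_iff.1 hv
        filter_upwards [ih i hi, h₂ _ v hv] with s hs hs'
        rw [← hs', ← hs]
  | @rfind f _ ih =>
    obtain ⟨g, hg, h⟩ := ih
    -- The search is cut off at `s`, which is also the value returned on failure. Once `s > v` and
    -- the guesses at the finitely many arguments `m ≤ v` are correct, it finds `v`.
    refine ⟨fun s a => (List.range s).findIdx fun m => decide (g s (Nat.pair a m) = 0), ?_,
      fun a v hv => ?_⟩
    · refine Primrec.list_findIdx (Primrec.list_range.comp Primrec.fst) ?_
      exact (PrimrecRel.comp Primrec.eq (hg.comp (Primrec.fst.comp Primrec.fst)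
        (Primrec₂.natPair.comp (Primrec.snd.comp Primrec.fst) Primrec.snd))
        (Primrec.const 0)).decide.to₂
    · obtain ⟨hv0, hlt⟩ := Nat.mem_rfind.1 hv
      have h0 : 0 ∈ f (Nat.pair a v) := by
        obtain ⟨w, hw, hw'⟩ := (Part.mem_map_iff _).1 hv0
        simp only [decide_eq_true_eq] at hw'
        exact hw' ▸ hw
      have h1 : ∀ᶠ s in atTop, ∀ m < v, g s (Nat.pair a m) ≠ 0 := by
        refine (eventually_all_finite (Set.finite_lt_nat v)).2 fun m hm => ?_
        obtain ⟨w, hw, hw'⟩ := (Part.mem_map_iff _).1 (hlt hm)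
        simp only [decide_eq_false_iff_not] at hw'
        filter_upwards [h _ w hw] with s hs
        rwa [hs]
      filter_upwards [h _ 0 h0, h1, eventually_gt_atTop v] with s hs hs' hlt
      rw [List.findIdx_eq (by simpa using hlt)]
      refine ⟨by simpa using hs, fun j hj => by simpa using hs' j hj⟩

open Filter in
theorem DecidablePredIn.exists_primrec_limit {α : Type*} [Primcodable α] {p : α → Prop}
    (hp : DecidablePredIn {zeroJump} p) :
    ∃ q : ℕ → α → Prop, PrimrecRel q ∧ ∀ a, ∀ᶠ s in atTop, (q s a ↔ p a) := by
  obtain ⟨_, h⟩ := hp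
  obtain ⟨g, hg, hlim⟩ := exists_primrec_limit_of_recursiveIn_zeroJump h
  refine ⟨fun s a => g s (Encodable.encode a) = 1,
    Primrec.eq.comp (hg.comp Primrec.fst (Primrec.encode.comp Primrec.snd)) (Primrec.const 1),
    fun a => ?_⟩
  filter_upwards [hlim (Encodable.encode a) (Encodable.encode (decide (p a)))
    (by simp)] with s hs
  rw [hs]
  by_cases h : p a <;> simp [h]

/-! ### The stage construction and its linear order. -/

/-- A sequence of guesses at a linear order on a set of natural numbers together with its
successor relation; the first argument is the stage of the guess. -/
structure StageGuess where
  dom : ℕ → ℕ → Prop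
  lt : ℕ → ℕ → ℕ → Prop
  sc : ℕ → ℕ → ℕ → Prop

namespace StageGuess

variable (G : StageGuess)

/-- The guesses at stages `s` and `t` agree on the labels up to `n`. -/
def Agree (n s t : ℕ) : Prop :=
  ∀ i ≤ n, ∀ j ≤ n, (G.dom s i ↔ G.dom t i) ∧ (G.lt s i j ↔ G.lt t i j) ∧
    (G.sc s i j ↔ G.sc t i j)

/-- The guess on the labels up to `n` does not change between the stages `t` and `s`. -/
def Stable (n t s : ℕ) : Prop :=
  ∀ u ≤ s, t ≤ u → G.Agree n u s

/-- The guess at stage `s` on the labels up to `n` is a strict linear order in which nothing lies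
between a label and its successor. -/
def Coherent (n s : ℕ) : Prop :=
  ∀ i ≤ n, ∀ j ≤ n, ∀ k ≤ n, G.dom s i → G.dom s j → G.dom s k →
    ¬ G.lt s i i ∧ (G.lt s i j ∨ i = j ∨ G.lt s j i) ∧
    (G.lt s i j → G.lt s j k → G.lt s i k) ∧ ¬ (G.sc s i j ∧ G.lt s i k ∧ G.lt s k j)

/-- Stage `s` introduces a representative of the label `n`: the guess on the labels up to `n` is
coherent, contains `n`, and has last changed exactly `n` stages ago. -/
def Acts (n s : ℕ) : Prop :=
  n ≤ s ∧ G.Stable n (s - n) s ∧ (s = n ∨ ¬ G.Stable n (s - n - 1) s) ∧ G.dom s n ∧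
    G.Coherent n s

/-- At stage `s`, the element `t` still represents the label `k`. -/
def Valid (k t s : ℕ) : Prop := G.Acts k t ∧ G.Stable k t s

/-- The rule placing the new element `s` below the older element `b`, in terms of the order `R` of
the older elements. -/
def Below (R : ℕ → ℕ → Prop) (s b : ℕ) : Prop :=
  ∃ n ≤ s, G.Acts n s ∧
    ((∃ t < s, ∃ k < n, G.Valid k t s ∧ G.lt s n k ∧ (t = b ∨ R t b)) ∨
      ((∃ t < s, ∃ k < n, G.Valid k t s) ∧ ∀ t < s, ∀ k < n, G.Valid k t s → G.lt s n k))

/-- The order of the elements introduced before stage `s`. -/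
def orderAt : ℕ → ℕ → ℕ → Prop
  | 0, _, _ => False
  | s + 1, x, y => (x < s ∧ y < s ∧ orderAt s x y) ∨ (x = s ∧ y < s ∧ G.Below (orderAt s) s y) ∨
      (x < s ∧ y = s ∧ ¬ G.Below (orderAt s) s x)

/-- The order of all elements. -/
def Prec (x y : ℕ) : Prop := G.orderAt (max x y + 1) x y

variable {G}

theorem orderAt_iff_prec {s x y : ℕ} (hx : x < s) (hy : y < s) :
    G.orderAt s x y ↔ G.Prec x y := by
  obtain ⟨d, rfl⟩ : ∃ d, s = max x y + 1 + d := ⟨s - (max x y + 1), by omega⟩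
  induction d with
  | zero => rfl
  | succ d ih =>
    have hx' : x < max x y + 1 + d := by omega
    have hy' : y < max x y + 1 + d := by omega
    rw [← ih hx' hy', ← add_assoc, orderAt]
    simp [hx', hy', hx'.ne, hy'.ne]

/-- The rule consults only older elements, so the partial order so far, the full order and a lookup
table are interchangeable in it. -/
theorem below_congr {R R' : ℕ → ℕ → Prop} {s b : ℕ} (h : ∀ t < s, (R t b ↔ R' t b)) :
    G.Below R s b ↔ G.Below R' s b := by
  unfold Below
  refine exists_congr fun n => and_congr_right fun _ => and_congr_right fun _ =>
    or_congr_left (exists_congr fun t => and_congr_right fun ht => ?_)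
  rw [h t ht]

theorem below_orderAt_iff {s b : ℕ} (h : b < s) :
    G.Below (G.orderAt s) s b ↔ G.Below G.Prec s b :=
  below_congr fun _ ht => orderAt_iff_prec ht h

theorem prec_iff_below {s b : ℕ} (h : b < s) : G.Prec s b ↔ G.Below G.Prec s b := by
  rw [Prec, max_eq_left h.le, orderAt, ← below_orderAt_iff h]
  simp [h]

theorem prec_iff_not_below {s b : ℕ} (h : b < s) : G.Prec b s ↔ ¬ G.Below G.Prec s b := by
  rw [Prec, max_eq_right h.le, orderAt, ← below_orderAt_iff h]
  simp [h, h.ne]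

theorem prec_irrefl (s : ℕ) : ¬ G.Prec s s := by
  rw [Prec, max_self, orderAt]
  simp

theorem prec_iff_not_prec {x y : ℕ} (h : x ≠ y) : G.Prec x y ↔ ¬ G.Prec y x := by
  rcases h.lt_or_gt with h | h
  · rw [prec_iff_not_below h, prec_iff_below h]
  · rw [prec_iff_not_below h, prec_iff_below h, not_not]

theorem prec_trichotomous (x y : ℕ) : G.Prec x y ∨ x = y ∨ G.Prec y x := by
  by_cases h : x = y
  · exact Or.inr (Or.inl h)
  · rw [prec_iff_not_prec h]
    tauto

/-- The elements above the new one form an upper set; transitivity of the extended order rests on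
this. -/
theorem below_mono {R : ℕ → ℕ → Prop} {s b b' : ℕ}
    (hR : ∀ t < s, R t b → R t b') (h : R b b') (hb : G.Below R s b) : G.Below R s b' := by
  obtain ⟨n, hn, ha, ⟨t, ht, k, hk, hv, hl, hb⟩ | hb⟩ := hb
  · refine ⟨n, hn, ha, Or.inl ⟨t, ht, k, hk, hv, hl, Or.inr ?_⟩⟩
    rcases hb with rfl | hb
    exacts [h, hR t ht hb]
  · exact ⟨n, hn, ha, Or.inr hb⟩

theorem prec_trans {x y z : ℕ} (hxy : G.Prec x y) (hyz : G.Prec y z) : G.Prec x z := by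
  suffices H : ∀ s, ∀ x < s, ∀ y < s, ∀ z < s, G.Prec x y → G.Prec y z → G.Prec x z from
    H (x + y + z + 1) x (by omega) y (by omega) z (by omega) hxy hyz
  intro s
  induction s with
  | zero => intro x hx; omega
  | succ s ih =>
    have up : ∀ b < s, ∀ b' < s, G.Prec b b' → G.Below G.Prec s b → G.Below G.Prec s b' :=
      fun b hb b' hb' h => below_mono (fun t ht h' => ih t ht b hb b' hb' h' h) h
    intro x hx y hy z hz hxy hyz
    have hne : x ≠ z := by
      rintro rfl
      by_cases h : x = y
      · exact prec_irrefl y (h ▸ hxy)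
      · exact (prec_iff_not_prec h).1 hxy hyz
    rcases Nat.lt_succ_iff_lt_or_eq.1 hx with hx | rfl <;>
    rcases Nat.lt_succ_iff_lt_or_eq.1 hy with hy | rfl <;>
    rcases Nat.lt_succ_iff_lt_or_eq.1 hz with hz | rfl
    · exact ih x hx y hy z hz hxy hyz
    · rw [prec_iff_not_below hx]
      rw [prec_iff_not_below hy] at hyz
      exact fun h => hyz (up x hx y hy hxy h)
    · rw [prec_iff_not_prec hne]
      rw [prec_iff_not_below hx] at hxy
      rw [prec_iff_below hz] at hyz
      exact fun h => hxy (up z hz x hx h hyz)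
    · exact (prec_irrefl _ hyz).elim
    · rw [prec_iff_below hz]
      rw [prec_iff_below hy] at hxy
      exact up y hy z hz hyz hxy
    · exact (hne rfl).elim
    · exact (prec_irrefl _ hxy).elim
    · exact (hne rfl).elim

theorem isStrictTotalOrder_prec : IsStrictTotalOrder ℕ G.Prec where
  trichotomous x y hx hy := (prec_trichotomous x y).elim (fun h => (hx h).elim)
    fun h => h.elim id fun h => (hy h).elim
  irrefl := prec_irrefl
  trans _ _ _ := prec_trans

/-! ### Stability, and uniqueness of valid representatives. -/

theorem Agree.symm {n s t : ℕ} (h : G.Agree n s t) : G.Agree n t s := fun i hi j hj =>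
  ⟨(h i hi j hj).1.symm, (h i hi j hj).2.1.symm, (h i hi j hj).2.2.symm⟩

theorem Agree.trans {n s t u : ℕ} (h : G.Agree n s t) (h' : G.Agree n t u) : G.Agree n s u :=
  fun i hi j hj => ⟨(h i hi j hj).1.trans (h' i hi j hj).1,
    (h i hi j hj).2.1.trans (h' i hi j hj).2.1, (h i hi j hj).2.2.trans (h' i hi j hj).2.2⟩

theorem Agree.mono {n m s t : ℕ} (h : G.Agree n s t) (hm : m ≤ n) : G.Agree m s t :=
  fun i hi j hj => h i (hi.trans hm) j (hj.trans hm)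

theorem Stable.mono {n m r r' t s : ℕ} (h : G.Stable n r s) (hm : m ≤ n) (hr : r ≤ r')
    (hrt : r ≤ t) (ht : t ≤ s) : G.Stable m r' t := fun u hu hr' =>
  ((h u (hu.trans ht) (hr.trans hr')).trans (h t ht hrt).symm).mono hm

theorem Stable.trans {n r t s : ℕ} (h : G.Stable n r t) (h' : G.Stable n t s) (hts : t ≤ s) :
    G.Stable n r s := fun u hu hr => by
  rcases le_or_gt u t with hut | hut
  · exact (h u hut hr).trans (h' t hts le_rfl)
  · exact h' u hu hut.le

theorem Acts.le_add {k t r : ℕ} (h : G.Acts k t) (hr : G.Stable k r t) : t ≤ r + k := by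
  by_contra! hlt
  obtain ⟨-, -, h1 | h1, -⟩ := h
  · omega
  · exact h1 (hr.mono le_rfl (by omega) (by omega) le_rfl)

/-- Here `t - k` and `t' - k'` are the stages of the last change for `k` and `k'`. The larger label
watches more of the guess, so its last change is no earlier. -/
theorem Valid.add_le {k k' t t' s : ℕ} (h : G.Valid k t s) (h' : G.Valid k' t' s)
    (hts : t ≤ s) (hk : k ≤ k') (ht : t' ≤ t) : t + k' ≤ t' + k := by
  obtain ⟨ha, -⟩ := h
  obtain ⟨⟨hle, hst, -⟩, hs⟩ := h'
  have := ha.le_add ((hst.trans hs (ht.trans hts)).mono hk le_rfl (by omega) hts)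
  omega

/-- The delay by the label itself makes this strict, even when both labels last changed at the same
stage. Hence a stage serves at most one label. -/
theorem Valid.lt_of_lt {k k' t t' s : ℕ} (h : G.Valid k t s) (h' : G.Valid k' t' s)
    (hts : t ≤ s) (hk : k < k') : t < t' := by
  by_contra! ht
  have := h.add_le h' hts hk.le ht
  omega

theorem Valid.label_unique {k k' t s : ℕ} (h : G.Valid k t s) (h' : G.Valid k' t s)
    (ht : t ≤ s) : k = k' := by
  rcases lt_trichotomy k k' with hk | hk | hk
  · exact absurd (h.lt_of_lt h' ht hk) (lt_irrefl _)
  · exact hk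
  · exact absurd (h'.lt_of_lt h ht hk) (lt_irrefl _)

theorem Valid.unique {k t t' s : ℕ} (h : G.Valid k t s) (h' : G.Valid k t' s)
    (ht : t ≤ s) (ht' : t' ≤ s) : t = t' := by
  rcases le_total t t' with hle | hle
  · have := h'.add_le h ht' le_rfl hle
    omega
  · have := h.add_le h' ht le_rfl hle
    omega

theorem Acts.valid {n s : ℕ} (h : G.Acts n s) : G.Valid n s s :=
  ⟨h, h.2.1.mono le_rfl (Nat.sub_le _ _) (Nat.sub_le _ _) le_rfl⟩

theorem Acts.unique {n n' s : ℕ} (h : G.Acts n s) (h' : G.Acts n' s) : n = n' :=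
  h.valid.label_unique h'.valid le_rfl

theorem Valid.mono {k t t' s : ℕ} (h : G.Valid k t s) (ht : t ≤ t') (hs : t' ≤ s) :
    G.Valid k t t' :=
  ⟨h.1, h.2.mono le_rfl le_rfl ht hs⟩

theorem Valid.agree {k t s : ℕ} (h : G.Valid k t s) (ht : t ≤ s) : G.Agree k t s :=
  h.2 t ht le_rfl

theorem Valid.dom {k t s : ℕ} (h : G.Valid k t s) (ht : t ≤ s) : G.dom s k :=
  (h.agree ht k le_rfl k le_rfl).1.1 h.1.2.2.2.1

/-- The elements representing labels are ordered as the labels are. -/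
theorem Acts.prec_iff {m s : ℕ} (hm : G.Acts m s) {k t : ℕ} (hk : k < m) (ht : t < s)
    (hv : G.Valid k t s) : G.Prec s t ↔ G.lt s m k := by
  induction s using Nat.strong_induction_on generalizing m k t with
  | _ s ih =>
  have hdm := hm.2.2.2.1
  have hco := hm.2.2.2.2
  -- Of two valid representatives, the one with the larger label came later; induction applies at
  -- its stage, whose guess still agrees with that at `s`.
  have pair : ∀ k' < m, ∀ t' < s, G.Valid k' t' s → G.Prec t' t → G.lt s k' k := by
    intro k' hk' t' ht' hv' hp
    rcases lt_trichotomy k' k with h | rfl | h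
    · have htt := hv'.lt_of_lt hv ht'.le h
      have h1 := ih t ht hv.1 h htt (hv'.mono htt.le ht.le)
      rw [prec_iff_not_prec htt.ne, h1, (hv.agree ht.le k le_rfl k' h.le).2.1] at hp
      rcases (hco k' hk'.le k hk.le k hk.le (hv'.dom ht'.le) (hv.dom ht.le) (hv.dom ht.le)).2.1
        with h2 | h2 | h2
      · exact h2
      · exact absurd h2 h.ne
      · exact absurd h2 hp
    · exact absurd hp (hv'.unique hv ht'.le ht.le ▸ prec_irrefl t')
    · have htt := hv.lt_of_lt hv' ht.le h
      have h1 := ih t' ht' hv'.1 h htt (hv.mono htt.le ht'.le)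
      rwa [h1, (hv'.agree ht'.le k' le_rfl k h.le).2.1] at hp
  rw [prec_iff_below ht]
  constructor
  · rintro ⟨n, -, hn, H⟩
    obtain rfl := hm.unique hn
    rcases H with ⟨t', ht', k', hk', hv', hl, rfl | hp⟩ | ⟨-, H⟩
    · rwa [hv.label_unique hv' ht.le]
    · exact (hco _ le_rfl k' hk'.le k hk.le hdm (hv'.dom ht'.le) (hv.dom ht.le)).2.2.1 hl
        (pair k' hk' t' ht' hv' hp)
    · exact H t ht k hk hv
  · exact fun hl => ⟨m, hm.1, hm, Or.inl ⟨t, ht, k, hk, hv, hl, Or.inl rfl⟩⟩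

end StageGuess

/-! ### Converging guesses: the limit order is isomorphic to `L`. -/

/-- The elements introduced by the stages, with their order. -/
def StageGuess.Element (_ : StageGuess) : Type := ℕ

noncomputable instance (G : StageGuess) : LinearOrder G.Element :=
  have : IsStrictTotalOrder G.Element G.Prec := G.isStrictTotalOrder_prec
  @linearOrderOfSTO G.Element G.Prec this fun _ _ => Classical.dec _

open Filter in
/-- The guesses converge to relations on the natural numbers which, on the range of `e`, are the
order and the covering relation of `L`. -/
structure StageGuess.Converges (G : StageGuess) {L : Type*} [LinearOrder L] (e : L → ℕ) :
    Prop where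
  inj : e.Injective
  dom : ∀ i, ∀ᶠ s in atTop, (G.dom s i ↔ i ∈ Set.range e)
  lt : ∃ T : ℕ → ℕ → Prop, (∀ i j, ∀ᶠ s in atTop, (G.lt s i j ↔ T i j)) ∧
    ∀ x y, T (e x) (e y) ↔ x < y
  sc : ∃ T : ℕ → ℕ → Prop, (∀ i j, ∀ᶠ s in atTop, (G.sc s i j ↔ T i j)) ∧
    ∀ x y, T (e x) (e y) ↔ x ⋖ y

namespace StageGuess.Converges

variable {G : StageGuess} {L : Type*} [LinearOrder L] {e : L → ℕ} (h : G.Converges e)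
include h

open Filter in
theorem exists_agree (n : ℕ) : ∃ r, ∀ s ≥ r, ∀ t ≥ r, G.Agree n s t := by
  obtain ⟨T, hT, -⟩ := h.lt
  obtain ⟨S, hS, -⟩ := h.sc
  have key : ∀ᶠ s in atTop, ∀ i ≤ n, ∀ j ≤ n, (G.dom s i ↔ i ∈ Set.range e) ∧
      (G.lt s i j ↔ T i j) ∧ (G.sc s i j ↔ S i j) := by
    refine (eventually_all_finite (Set.finite_le_nat n)).2 fun i _ =>
      (eventually_all_finite (Set.finite_le_nat n)).2 fun j _ => ?_
    exact (h.dom i).and ((hT i j).and (hS i j))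
  obtain ⟨r, hr⟩ := eventually_atTop.1 key
  refine ⟨r, fun s hs t ht i hi j hj => ?_⟩
  obtain ⟨a, b, c⟩ := hr s hs i hi j hj
  obtain ⟨a', b', c'⟩ := hr t ht i hi j hj
  exact ⟨a.trans a'.symm, b.trans b'.symm, c.trans c'.symm⟩

open Classical in
/-- The least stage after which the guess on the labels up to `n` does not change. -/
noncomputable def modulus (n : ℕ) : ℕ := Nat.find (h.exists_agree n)

/-- The stage which introduces the final representative of the label `n`. -/
noncomputable def rep (n : ℕ) : ℕ := h.modulus n + n

theorem agree {n s t : ℕ} (hs : h.modulus n ≤ s) (ht : h.modulus n ≤ t) : G.Agree n s t := by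
  classical
  exact Nat.find_spec (h.exists_agree n) s hs t ht

theorem modulus_le {n r : ℕ} (hr : ∀ s ≥ r, ∀ t ≥ r, G.Agree n s t) : h.modulus n ≤ r := by
  classical
  exact Nat.find_min' _ hr

theorem stable {n t s : ℕ} (ht : h.modulus n ≤ t) : G.Stable n t s := fun _ _ hu =>
  h.agree (ht.trans hu) (by omega)

theorem modulus_le_of_stable {n t s : ℕ} (hs : h.modulus n ≤ s) (hst : G.Stable n t s) :
    h.modulus n ≤ t := by
  have key : ∀ u ≥ t, G.Agree n u s := fun u hu => by
    rcases le_total u s with hus | hus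
    · exact hst u hus hu
    · exact h.agree (hs.trans hus) hs
  exact h.modulus_le fun u hu v hv => (key u hu).trans (key v hv).symm

theorem modulus_mono {n m : ℕ} (hnm : n ≤ m) : h.modulus n ≤ h.modulus m :=
  h.modulus_le fun _ hs _ ht => (h.agree hs ht).mono hnm

theorem rep_lt {n m : ℕ} (hnm : n < m) : h.rep n < h.rep m := by
  have := h.modulus_mono hnm.le
  simp only [rep]
  omega

theorem le_rep (n : ℕ) : n ≤ h.rep n := Nat.le_add_left _ _

theorem modulus_le_rep (n : ℕ) : h.modulus n ≤ h.rep n := Nat.le_add_right _ _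

open Filter in
theorem dom_iff {s i : ℕ} (hs : h.modulus i ≤ s) : G.dom s i ↔ i ∈ Set.range e := by
  obtain ⟨t, ht, ht'⟩ := ((h.dom i).and (eventually_ge_atTop (h.modulus i))).exists
  rw [← ht]
  exact (h.agree hs ht' i le_rfl i le_rfl).1

open Filter in
theorem lt_iff {s n : ℕ} (hs : h.modulus n ≤ s) {x y : L} (hx : e x ≤ n) (hy : e y ≤ n) :
    G.lt s (e x) (e y) ↔ x < y := by
  obtain ⟨T, hT, hT'⟩ := h.lt
  obtain ⟨t, ht, ht'⟩ := ((hT (e x) (e y)).and (eventually_ge_atTop (h.modulus n))).exists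
  rw [← hT', ← ht]
  exact (h.agree hs ht' _ hx _ hy).2.1

open Filter in
theorem sc_iff {s n : ℕ} (hs : h.modulus n ≤ s) {x y : L} (hx : e x ≤ n) (hy : e y ≤ n) :
    G.sc s (e x) (e y) ↔ x ⋖ y := by
  obtain ⟨T, hT, hT'⟩ := h.sc
  obtain ⟨t, ht, ht'⟩ := ((hT (e x) (e y)).and (eventually_ge_atTop (h.modulus n))).exists
  rw [← hT', ← ht]
  exact (h.agree hs ht' _ hx _ hy).2.2

theorem coherent {n s : ℕ} (hs : h.modulus n ≤ s) : G.Coherent n s := by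
  intro i hi j hj k hk di dj dk
  obtain ⟨x, rfl⟩ := (h.dom_iff ((h.modulus_mono hi).trans hs)).1 di
  obtain ⟨y, rfl⟩ := (h.dom_iff ((h.modulus_mono hj).trans hs)).1 dj
  obtain ⟨z, rfl⟩ := (h.dom_iff ((h.modulus_mono hk).trans hs)).1 dk
  rw [h.lt_iff hs hi hi, h.lt_iff hs hi hj, h.lt_iff hs hj hi, h.lt_iff hs hj hk,
    h.lt_iff hs hi hk, h.lt_iff hs hk hj, h.sc_iff hs hi hj, h.inj.eq_iff]
  exact ⟨lt_irrefl x, lt_trichotomy x y, lt_trans, fun ⟨hc, h1, h2⟩ => hc.2 h1 h2⟩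

theorem acts_rep (x : L) : G.Acts (e x) (h.rep (e x)) := by
  have hsub : h.rep (e x) - e x = h.modulus (e x) := Nat.add_sub_cancel _ _
  refine ⟨h.le_rep _, hsub ▸ h.stable le_rfl, ?_, (h.dom_iff (h.modulus_le_rep _)).2 ⟨x, rfl⟩,
    h.coherent (h.modulus_le_rep _)⟩
  rw [hsub]
  by_cases h0 : h.modulus (e x) = 0
  · exact Or.inl (by simp [rep, h0])
  · refine Or.inr fun hst => ?_
    have := h.modulus_le_of_stable (h.modulus_le_rep _) hst
    omega

theorem valid_rep {x : L} {s : ℕ} : G.Valid (e x) (h.rep (e x)) s :=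
  ⟨h.acts_rep x, h.stable (h.modulus_le_rep _)⟩

/-- After the modulus validity persists to all later stages, where uniqueness compares `t` with the
final representative. -/
theorem eq_rep_of_valid {k t s : ℕ} (hs : h.modulus k ≤ s) (hts : t ≤ s) (hv : G.Valid k t s) :
    ∃ x, k = e x ∧ t = h.rep (e x) := by
  obtain ⟨x, rfl⟩ := (h.dom_iff hs).1 (hv.dom hts)
  refine ⟨x, rfl, ?_⟩
  have hv' : G.Valid (e x) t (max s (h.rep (e x))) :=
    ⟨hv.1, hv.2.trans (h.stable hs) (le_max_left _ _)⟩
  exact hv'.unique h.valid_rep (hts.trans (le_max_left _ _)) (le_max_right _ _)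

theorem lt_of_acts {n m s : ℕ} (hs : h.rep n < s) (ha : G.Acts m s) : n < m := by
  by_contra! hmn
  have h1 := h.modulus_mono hmn
  have := ha.le_add (h.stable h1)
  simp only [rep] at hs
  omega

theorem prec_rep_iff (x y : L) : G.Prec (h.rep (e x)) (h.rep (e y)) ↔ x < y := by
  rcases lt_trichotomy (e x) (e y) with hlt | heq | hlt
  · rw [prec_iff_not_prec (h.rep_lt hlt).ne, (h.acts_rep y).prec_iff hlt (h.rep_lt hlt)
      h.valid_rep, h.lt_iff (h.modulus_le_rep _) le_rfl hlt.le, not_lt]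
    exact ⟨fun hle => hle.lt_of_ne fun he => hlt.ne (congrArg e he), le_of_lt⟩
  · obtain rfl := h.inj heq
    exact iff_of_false (prec_irrefl _) (lt_irrefl _)
  · rw [(h.acts_rep x).prec_iff hlt (h.rep_lt hlt) h.valid_rep,
      h.lt_iff (h.modulus_le_rep _) le_rfl hlt.le]

/-- Being below something, `b` was not put on top by default, so a label `m` acts at stage `b`. It
exceeds both settled labels and would be guessed strictly between them, against coherence with the
correctly guessed `x ⋖ y`. -/
theorem not_between {x y : L} (hxy : x ⋖ y) {b : ℕ} (hx : h.rep (e x) < b)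
    (hy : h.rep (e y) < b) : ¬ (G.Prec (h.rep (e x)) b ∧ G.Prec b (h.rep (e y))) := by
  rintro ⟨h1, h2⟩
  obtain ⟨m, -, ha, -⟩ := (prec_iff_below hy).1 h2
  have hxm := h.lt_of_acts hx ha
  have hym := h.lt_of_acts hy ha
  have hdx := (h.valid_rep (x := x)).dom hx.le
  have hdy := (h.valid_rep (x := y)).dom hy.le
  rw [prec_iff_not_prec hx.ne, ha.prec_iff hxm hx h.valid_rep] at h1
  rw [ha.prec_iff hym hy h.valid_rep] at h2
  have hco := ha.2.2.2.2
  have hmod : h.modulus (max (e x) (e y)) ≤ b := by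
    rcases max_choice (e x) (e y) with hm | hm <;> rw [hm]
    · exact (h.modulus_le_rep _).trans hx.le
    · exact (h.modulus_le_rep _).trans hy.le
  have hsc := (h.sc_iff hmod (le_max_left (e x) (e y)) (le_max_right _ _)).2 hxy
  have hd := ha.2.2.2.1
  rcases (hco _ hxm.le m le_rfl m le_rfl hdx hd hd).2.1 with h3 | h3 | h3
  · exact (hco _ hxm.le _ hym.le m le_rfl hdx hdy hd).2.2.2 ⟨hsc, h3, h2⟩
  · exact hxm.ne h3
  · exact h1 h3

theorem exists_prec (hpred : ∀ x : L, ∃ y : L, y ⋖ x) [Nonempty L] (b : ℕ) :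
    ∃ x, G.Prec (h.rep (e x)) b := by
  classical
  obtain ⟨y₀⟩ := ‹Nonempty L›
  set N := max b (e y₀) with hN
  have hfin : {z : L | e z ≤ N}.Finite := (Set.finite_le_nat N).preimage h.inj.injOn
  obtain ⟨z₀, -, hz₀⟩ := Set.exists_min_image _ id hfin ⟨y₀, le_max_right b (e y₀)⟩
  obtain ⟨w, hw⟩ := hpred z₀
  -- Take the least label of a point below all points with labels up to `N`. By minimality it lies
  -- below every point of smaller label, so its final representative is put at the bottom, after `b`
  -- has appeared.
  have hex : ∃ n, ∃ x, e x = n ∧ ∀ z, e z ≤ N → x < z :=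
    ⟨e w, w, rfl, fun z hz => hw.lt.trans_le (hz₀ z hz)⟩
  obtain ⟨x, hx, hxN⟩ := Nat.find_spec hex
  have hmin : ∀ z, e z < e x → ∃ z', e z' ≤ N ∧ z' ≤ z := by
    intro z hz
    have := Nat.find_min hex (hx ▸ hz)
    push Not at this
    exact this z rfl
  have hNx : N < e x := by
    by_contra! hle
    exact lt_irrefl x (hxN x hle)
  have hbx : b < h.rep (e x) := ((le_max_left _ _).trans_lt hNx).trans_le (h.le_rep _)
  have hy₀ : e y₀ < e x := (le_max_right _ _).trans_lt hNx
  refine ⟨x, (prec_iff_below hbx).2 ⟨e x, h.le_rep _, h.acts_rep x, Or.inr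
    ⟨⟨_, h.rep_lt hy₀, _, hy₀, h.valid_rep⟩, fun t ht k hk hv => ?_⟩⟩⟩
  obtain ⟨z, rfl, -⟩ := h.eq_rep_of_valid ((h.modulus_mono hk.le).trans (h.modulus_le_rep _))
    ht.le hv
  rw [h.lt_iff (h.modulus_le_rep _) le_rfl hk.le]
  obtain ⟨z', hz', hle⟩ := hmin z hk
  exact (hxN z' hz').trans_le hle

/-- Small labels are finitely many, so they yield a maximum `i`. A larger label is represented after
`b`; if not above `b`, it was put either below a representative of smaller label not above `b`,
where induction applies, or below all of them, including that of `i`. -/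
theorem exists_greatest (hpred : ∀ x : L, ∃ y : L, y ⋖ x) [Nonempty L] (b : ℕ) :
    ∃ x, IsGreatest {x | ¬ G.Prec b (h.rep (e x))} x := by
  obtain ⟨x₀, hx₀⟩ := h.exists_prec hpred b
  have hx₀' : ¬ G.Prec b (h.rep (e x₀)) := fun h' => prec_irrefl b (prec_trans h' hx₀)
  have hfin : {z : L | e z ≤ max b (e x₀) ∧ ¬ G.Prec b (h.rep (e z))}.Finite :=
    ((Set.finite_le_nat (max b (e x₀))).preimage h.inj.injOn).subset fun z hz => hz.1
  obtain ⟨i, ⟨hi, hi'⟩, hmax⟩ := Set.exists_max_image _ id hfin ⟨x₀, le_max_right _ _, hx₀'⟩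
  refine ⟨i, hi', fun x hx => ?_⟩
  induction hn : e x using Nat.strong_induction_on generalizing x with
  | _ n ih =>
  subst hn
  rcases le_or_gt (e x) (max b (e x₀)) with hle | hlt
  · exact hmax x ⟨hle, hx⟩
  have hbx : b < h.rep (e x) := ((le_max_left _ _).trans_lt hlt).trans_le (h.le_rep _)
  have hx' := hx
  rw [Set.mem_ofPred_eq, prec_iff_not_below hbx, not_not] at hx'
  obtain ⟨n, -, ha, H⟩ := hx'
  obtain rfl := ha.unique (h.acts_rep x)
  rcases H with ⟨t, ht, k, hk, hv, hl, hb⟩ | ⟨-, H⟩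
  · obtain ⟨z, rfl, rfl⟩ := h.eq_rep_of_valid
      ((h.modulus_mono hk.le).trans (h.modulus_le_rep _)) ht.le hv
    rw [h.lt_iff (h.modulus_le_rep _) le_rfl hk.le] at hl
    refine hl.le.trans (ih _ hk z ?_ rfl)
    rcases hb with hb | hb
    · exact hb ▸ prec_irrefl _
    · exact fun h' => prec_irrefl _ (prec_trans hb h')
  · have hix := hi.trans_lt hlt
    have := H _ (h.rep_lt hix) _ hix h.valid_rep
    exact ((h.lt_iff (h.modulus_le_rep _) le_rfl hix.le).1 this).le

omit h in
/-- The order built from converging guesses at a discrete linear order is isomorphic to it. -/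
theorem exists_equiv (h : G.Converges e) (hsucc : ∀ x : L, ∃ y : L, x ⋖ y)
    (hpred : ∀ x : L, ∃ y : L, y ⋖ x) [Nonempty L] :
    ∃ f : L ≃ ℕ, ∀ x y, x < y ↔ G.Prec (f x) (f y) := by
  choose π hπ using h.exists_greatest hpred
  obtain ⟨f⟩ := exists_orderIso_of_finite_fibers (B := G.Element) hsucc hpred π
    (fun b b' hb => (hπ b').2 fun h' => (hπ b).1 (by
      rcases (hb : b = b' ∨ G.Prec b b') with rfl | hb
      · exact h'
      · exact prec_trans hb h'))
    (fun x => ⟨h.rep (e x), by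
      refine le_antisymm ?_ ((hπ _).2 (prec_irrefl _))
      have := (hπ (h.rep (e x))).1
      rwa [Set.mem_ofPred_eq, h.prec_rep_iff, not_lt] at this⟩)
    (fun x => by
      obtain ⟨y, hy⟩ := hsucc x
      -- An element of the fibre over `x` lies between the final representatives of `x` and its
      -- successor `y`, so it cannot be newer than both.
      refine (Set.finite_le_nat (max (h.rep (e x)) (h.rep (e y)))).subset fun b hb => ?_
      obtain rfl : π b = x := hb
      by_contra hlt
      rw [Set.mem_ofPred_eq, not_le] at hlt
      obtain ⟨hxb, hyb⟩ := max_lt_iff.1 hlt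
      refine h.not_between hy hxb hyb ⟨?_, ?_⟩
      · exact (prec_iff_not_prec hxb.ne).2 (hπ b).1
      · by_contra hp
        exact hy.lt.not_ge ((hπ b).2 hp))
  exact ⟨f.symm.toEquiv, fun x y => f.symm.lt_iff_lt.symm⟩

end StageGuess.Converges

/-! ### Primitive recursiveness of the construction. -/

theorem primrec_id' {α : Type*} [Primcodable α] : Primrec fun a : α => a := Primrec.id

theorem Primrec.add {α : Type*} [Primcodable α] {f g : α → ℕ} (hf : Primrec f)
    (hg : Primrec g) : Primrec fun a => f a + g a := Primrec.nat_add.comp hf hg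

theorem Primrec.sub {α : Type*} [Primcodable α] {f g : α → ℕ} (hf : Primrec f)
    (hg : Primrec g) : Primrec fun a => f a - g a := Primrec.nat_sub.comp hf hg

theorem Primrec.list_length' {α β : Type*} [Primcodable α] [Primcodable β] {f : α → List β}
    (hf : Primrec f) : Primrec fun a => (f a).length := Primrec.list_length.comp hf

attribute [local fun_prop] Primrec primrec_id' Primrec.const Primrec.comp Primrec.pair
  Primrec.fst Primrec.snd Primrec.add Primrec.sub Primrec.list_length'

section Quantifiers

variable {α : Type*} [Primcodable α] {f : α → ℕ} {p : α → ℕ → Prop}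

theorem PrimrecPred.bounded_exists (hf : Primrec f)
    (hp : PrimrecPred fun q : α × ℕ => p q.1 q.2) : PrimrecPred fun a => ∃ x < f a, p a x := by
  have h : PrimrecRel fun (x : ℕ) (a : α) => p a x :=
    hp.comp (f := fun q : ℕ × α => (q.2, q.1)) (by fun_prop)
  exact (h.exists_mem_list.comp (Primrec.list_range.comp hf) Primrec.id).of_eq (by simp)

theorem PrimrecPred.bounded_forall (hf : Primrec f)
    (hp : PrimrecPred fun q : α × ℕ => p q.1 q.2) : PrimrecPred fun a => ∀ x < f a, p a x := by
  have h : PrimrecRel fun (x : ℕ) (a : α) => p a x :=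
    hp.comp (f := fun q : ℕ × α => (q.2, q.1)) (by fun_prop)
  exact (h.forall_mem_list.comp (Primrec.list_range.comp hf) Primrec.id).of_eq (by simp)

theorem PrimrecPred.bounded_forall_le (hf : Primrec f)
    (hp : PrimrecPred fun q : α × ℕ => p q.1 q.2) : PrimrecPred fun a => ∀ x ≤ f a, p a x :=
  (PrimrecPred.bounded_forall (f := fun a => f a + 1) (by fun_prop) hp).of_eq fun a => by
    simp only [Nat.lt_succ_iff]

theorem PrimrecPred.bounded_exists_le (hf : Primrec f)
    (hp : PrimrecPred fun q : α × ℕ => p q.1 q.2) : PrimrecPred fun a => ∃ x ≤ f a, p a x :=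
  (PrimrecPred.bounded_exists (f := fun a => f a + 1) (by fun_prop) hp).of_eq fun a => by
    simp only [Nat.lt_succ_iff]

theorem PrimrecPred.imp {p q : α → Prop} (hp : PrimrecPred p) (hq : PrimrecPred q) :
    PrimrecPred fun a => p a → q a :=
  (hp.not.or hq).of_eq fun a => by tauto

theorem PrimrecPred.iff {p q : α → Prop} (hp : PrimrecPred p) (hq : PrimrecPred q) :
    PrimrecPred fun a => p a ↔ q a :=
  ((hp.imp hq).and (hq.imp hp)).of_eq fun a => by tauto

end Quantifiers

namespace StageGuess

/-- The guesses are primitive recursive. -/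
structure IsPrimrec (G : StageGuess) : Prop where
  dom : PrimrecPred fun q : ℕ × ℕ => G.dom q.1 q.2
  lt : PrimrecPred fun q : ℕ × ℕ × ℕ => G.lt q.1 q.2.1 q.2.2
  sc : PrimrecPred fun q : ℕ × ℕ × ℕ => G.sc q.1 q.2.1 q.2.2

namespace IsPrimrec

variable {G : StageGuess} (h : G.IsPrimrec) {α : Type*} [Primcodable α] {a b c d : α → ℕ}
include h

theorem dom_comp (ha : Primrec a) (hb : Primrec b) : PrimrecPred fun x => G.dom (a x) (b x) :=
  h.dom.comp (f := fun x => (a x, b x)) (by fun_prop)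

theorem lt_comp (ha : Primrec a) (hb : Primrec b) (hc : Primrec c) :
    PrimrecPred fun x => G.lt (a x) (b x) (c x) :=
  h.lt.comp (f := fun x => (a x, b x, c x)) (by fun_prop)

theorem sc_comp (ha : Primrec a) (hb : Primrec b) (hc : Primrec c) :
    PrimrecPred fun x => G.sc (a x) (b x) (c x) :=
  h.sc.comp (f := fun x => (a x, b x, c x)) (by fun_prop)

theorem agree (ha : Primrec a) (hb : Primrec b) (hc : Primrec c) :
    PrimrecPred fun x => G.Agree (a x) (b x) (c x) := by
  refine .bounded_forall_le ha (.bounded_forall_le (by fun_prop) (.and (.iff ?_ ?_)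
    (.and (.iff ?_ ?_) (.iff ?_ ?_))))
  · exact h.dom_comp (by fun_prop) (by fun_prop)
  · exact h.dom_comp (by fun_prop) (by fun_prop)
  · exact h.lt_comp (by fun_prop) (by fun_prop) (by fun_prop)
  · exact h.lt_comp (by fun_prop) (by fun_prop) (by fun_prop)
  · exact h.sc_comp (by fun_prop) (by fun_prop) (by fun_prop)
  · exact h.sc_comp (by fun_prop) (by fun_prop) (by fun_prop)

theorem stable (ha : Primrec a) (hb : Primrec b) (hc : Primrec c) :
    PrimrecPred fun x => G.Stable (a x) (b x) (c x) := by
  refine .bounded_forall_le hc (.imp (Primrec.nat_le.comp ?_ ?_) (h.agree ?_ ?_ ?_)) <;> fun_prop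

theorem coherent (ha : Primrec a) (hb : Primrec b) :
    PrimrecPred fun x => G.Coherent (a x) (b x) := by
  refine .bounded_forall_le ha (.bounded_forall_le ?_ (.bounded_forall_le ?_
    (.imp (h.dom_comp ?_ ?_) (.imp (h.dom_comp ?_ ?_) (.imp (h.dom_comp ?_ ?_)
    (.and (.not (h.lt_comp ?_ ?_ ?_)) (.and (.or (h.lt_comp ?_ ?_ ?_)
    (.or (Primrec.eq.comp ?_ ?_) (h.lt_comp ?_ ?_ ?_)))
    (.and (.imp (h.lt_comp ?_ ?_ ?_) (.imp (h.lt_comp ?_ ?_ ?_) (h.lt_comp ?_ ?_ ?_)))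
    (.not (.and (h.sc_comp ?_ ?_ ?_) (.and (h.lt_comp ?_ ?_ ?_) (h.lt_comp ?_ ?_ ?_))))))))))))
    <;> fun_prop

theorem acts (ha : Primrec a) (hb : Primrec b) : PrimrecPred fun x => G.Acts (a x) (b x) := by
  refine .and (Primrec.nat_le.comp ?_ ?_) (.and (h.stable ?_ ?_ ?_)
    (.and (.or (Primrec.eq.comp ?_ ?_) (.not (h.stable ?_ ?_ ?_)))
    (.and (h.dom_comp ?_ ?_) (h.coherent ?_ ?_)))) <;> fun_prop

theorem valid (ha : Primrec a) (hb : Primrec b) (hc : Primrec c) :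
    PrimrecPred fun x => G.Valid (a x) (b x) (c x) :=
  .and (h.acts ha hb) (h.stable ha hb hc)

/-- The rule placing new elements is primitive recursive in the order of the old ones. -/
theorem below {R : α → ℕ → ℕ → Prop} (hR : PrimrecPred fun q : α × ℕ × ℕ => R q.1 q.2.1 q.2.2)
    (ha : Primrec a) (hb : Primrec b) : PrimrecPred fun x => G.Below (R x) (a x) (b x) := by
  refine .bounded_exists_le ha (.and (h.acts ?_ ?_) (.or (.bounded_exists ?_ (.bounded_exists ?_
    (.and (h.valid ?_ ?_ ?_) (.and (h.lt_comp ?_ ?_ ?_) (.or (Primrec.eq.comp ?_ ?_) ?_)))))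
    (.and (.bounded_exists ?_ (.bounded_exists ?_ (h.valid ?_ ?_ ?_)))
    (.bounded_forall ?_ (.bounded_forall ?_ (.imp (h.valid ?_ ?_ ?_) (h.lt_comp ?_ ?_ ?_)))))))
  case refine_13 =>
    exact hR.comp (f := fun q : ((α × ℕ) × ℕ) × ℕ => (q.1.1.1, q.1.2, b q.1.1.1)) (by fun_prop)
  all_goals fun_prop

/-- The order on the elements is primitive recursive. -/
theorem prec : PrimrecRel G.Prec := by
  classical
  let entry : List (List Bool) → ℕ → ℕ → Bool := fun l x y => (l.getD x []).getD y false
  have hentry : Primrec fun q : List (List Bool) × ℕ × ℕ => entry q.1 q.2.1 q.2.2 :=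
    (Primrec.list_getD false).comp ((Primrec.list_getD []).comp (by fun_prop) (by fun_prop))
      (by fun_prop)
  let R : List (List Bool) → ℕ → ℕ → Prop := fun l x y =>
    (y < x ∧ entry l x y = true) ∨ (x < y ∧ ¬ entry l y x = true)
  have hR : PrimrecPred fun q : List (List Bool) × ℕ × ℕ => R q.1 q.2.1 q.2.2 := by
    refine .or (.and (Primrec.nat_lt.comp ?_ ?_) (Primrec.eq.comp ?_ ?_))
      (.and (Primrec.nat_lt.comp ?_ ?_) (.not (Primrec.eq.comp ?_ ?_)))
    case refine_3 => exact hentry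
    case refine_7 =>
      exact hentry.comp (g := fun q : List (List Bool) × ℕ × ℕ => (q.1, q.2.2, q.2.1))
        (by fun_prop)
    all_goals fun_prop
  -- Row `s` records the position of `s` among the older elements. It is computed by strong
  -- recursion, with `R` reading the order off the earlier rows; the default values in `entry` are
  -- never reached there.
  let row : ℕ → List Bool := fun s => (List.range s).map fun b => decide (G.Below G.Prec s b)
  have hlen : ∀ s, (row s).length = s := fun s => by simp [row]
  have hrow : Primrec₂ fun (_ : Unit) s => row s := by
    refine Primrec.nat_strong_rec _ (g := fun _ l => some
      ((List.range l.length).map fun b => decide (G.Below (R l) l.length b))) ?_ fun _ n => ?_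
    · refine Primrec.option_some.comp (Primrec.list_map (Primrec.list_range.comp ?_)
        (PrimrecPred.decide (h.below (R := fun q : (Unit × List (List Bool)) × ℕ => R q.1.2)
          (a := fun q => q.1.2.length) (b := fun q => q.2) ?_ ?_ ?_)).to₂)
      case refine_2 =>
        exact hR.comp (f := fun q : ((Unit × List (List Bool)) × ℕ) × ℕ × ℕ =>
          (q.1.1.2, q.2.1, q.2.2)) (by fun_prop)
      all_goals fun_prop
    · simp only [List.length_map, List.length_range, Option.some.injEq, row]
      refine List.map_congr_left fun b hb => ?_
      rw [List.mem_range] at hb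
      rw [decide_eq_decide]
      refine below_congr fun t ht => ?_
      have hent : ∀ x < n, ∀ y < x, entry ((List.range n).map row) x y =
          decide (G.Below G.Prec x y) := by
        intro x hx y hy
        simp [entry, row, List.getD_eq_getElem?_getD, hx, hy]
      change (_ ∧ entry ((List.range n).map row) t b = true) ∨
        (_ ∧ ¬ entry ((List.range n).map row) b t = true) ↔ _
      rcases lt_trichotomy t b with hlt | rfl | hlt
      · rw [hent b hb t hlt, prec_iff_not_below hlt]
        simp [hlt, hlt.le]
      · simp [prec_irrefl]
      · rw [hent t ht b hlt, prec_iff_below hlt]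
        simp [hlt, hlt.le]
  have hbelow : PrimrecPred fun q : ℕ × ℕ => (row q.1).getD q.2 false = true := by
    refine Primrec.eq.comp ((Primrec.list_getD false).comp ?_ (by fun_prop)) (by fun_prop)
    exact hrow.comp (Primrec.const ()) Primrec.fst
  have hspec : ∀ x y, y < x → ((row x).getD y false = true ↔ G.Below G.Prec x y) := by
    intro x y hy
    simp [row, List.getD_eq_getElem?_getD, hy]
  refine PrimrecPred.of_eq (p := fun q : ℕ × ℕ =>
    (q.2 < q.1 ∧ (row q.1).getD q.2 false = true) ∨
      (q.1 < q.2 ∧ ¬ (row q.2).getD q.1 false = true)) ?_ fun q => ?_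
  · refine .or (.and (Primrec.nat_lt.comp Primrec.snd Primrec.fst) hbelow)
      (.and (Primrec.nat_lt.comp Primrec.fst Primrec.snd) (.not ?_))
    exact hbelow.comp (f := fun q : ℕ × ℕ => (q.2, q.1)) (by fun_prop)
  · obtain ⟨x, y⟩ := q
    change (_ ∧ (row x).getD y false = true) ∨ (_ ∧ ¬ (row y).getD x false = true) ↔ G.Prec x y
    rcases lt_trichotomy x y with hlt | rfl | hlt
    · rw [hspec y x hlt, prec_iff_not_below hlt]
      simp [hlt, hlt.le]
    · simp [prec_irrefl]
    · rw [hspec x y hlt, prec_iff_below hlt]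
      simp [hlt, hlt.le]

end IsPrimrec

end StageGuess

/-! ### The computable copy. -/

theorem decidablePredIn_of_primrecPred {α : Type*} [Primcodable α] {O : Set (ℕ →. ℕ)}
    {p : α → Prop} (hp : PrimrecPred p) : DecidablePredIn O p := by
  obtain ⟨hd, hp⟩ := hp
  exact ⟨hd, hp.to_comp.computableIn⟩

theorem mainTheorem7 {L : Type*} [LinearOrder L]
    (hsucc : ∀ x : L, ∃ y : L, x ⋖ y)
    (hpred : ∀ x : L, ∃ y : L, y ⋖ x)
    (hcopy : HasCopyComputableIn {zeroJump}
      ![fun x y : L => x < y, fun x y : L => x ⋖ y]) :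
    HasCopyComputableIn ∅ ![fun x y : L => x < y] := by
  -- The construction always has domain `ℕ`, so the empty order is treated separately.
  rcases isEmpty_or_nonempty L with hL | hL
  · refine ⟨⟨∅, fun _ _ _ => False⟩, ⟨decidablePredIn_of_primrecPred (.of_eq
      (.not (Primrec.eq.comp Primrec.id Primrec.id)) (by simp)), fun i =>
      decidablePredIn_of_primrecPred (.of_eq (.not (Primrec.eq.comp Primrec.id Primrec.id))
      (by simp))⟩, Equiv.equivOfIsEmpty L (∅ : Set ℕ), fun _ x => isEmptyElim x⟩
  obtain ⟨A, ⟨hdom, hrel⟩, e, he⟩ := hcopy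
  obtain ⟨d, hd, hd'⟩ := hdom.exists_primrec_limit
  obtain ⟨l, hl, hl'⟩ := (hrel 0).exists_primrec_limit
  obtain ⟨c, hc, hc'⟩ := (hrel 1).exists_primrec_limit
  let G : StageGuess := ⟨d, fun s i j => l s (i, j), fun s i j => c s (i, j)⟩
  have hprim : G.IsPrimrec := ⟨hd, hl, hc⟩
  have hrange : ∀ i, i ∈ A.domain ↔ i ∈ Set.range fun x => (e x : ℕ) := by
    refine fun i => ⟨fun hi => ⟨e.symm ⟨i, hi⟩, by simp⟩, ?_⟩
    rintro ⟨x, rfl⟩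
    exact (e x).2
  have hconv : G.Converges fun x => (e x : ℕ) :=
    { inj := Subtype.val_injective.comp e.injective
      dom := fun i => by simpa only [← hrange] using hd' i
      lt := ⟨_, fun i j => hl' (i, j), fun x y =>
        ⟨fun ⟨_, _, h⟩ => (he 0 x y).2 h, fun h => ⟨(e x).2, (e y).2, (he 0 x y).1 h⟩⟩⟩
      sc := ⟨_, fun i j => hc' (i, j), fun x y =>
        ⟨fun ⟨_, _, h⟩ => (he 1 x y).2 h, fun h => ⟨(e x).2, (e y).2, (he 1 x y).1 h⟩⟩⟩ }
  obtain ⟨f, hf⟩ := hconv.exists_equiv hsucc hpred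
  refine ⟨⟨Set.univ, fun _ x y => G.Prec x y⟩, ⟨decidablePredIn_of_primrecPred (.of_eq
    (Primrec.eq.comp Primrec.id Primrec.id) (by simp)), fun i =>
    decidablePredIn_of_primrecPred (.of_eq hprim.prec (by simp))⟩,
    f.trans (Equiv.Set.univ ℕ).symm, fun i x y => ?_⟩
  obtain rfl : i = 0 := Subsingleton.elim _ _
  exact hf x y
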